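/- Let $G=(V,E)$ be a connected undirected graph with $n\ge 2$ nodes, $m$ edges and diameter $D$, viewed as a synchronous network: in each round every node may send one message (a constant number of node identifiers and counters) over each incident edge. Let $\ell,\lambda\ge 1$ be integers. The algorithm Continuous-Random-Walk answers an online sequence of requests (each a source $s$, chosen adversarially or at random, possibly depending on the requests answered so far and their results) for a random walk of length $\ell$ from $s$. It first sets up a BFS tree, along which messages can afterwards be routed between any two nodes, and then works in phases. *Pre-processing.* At the start of a phase every node $v$ initiates $\lceil \deg(v)\log n\rceil$ independent random walks ("short walks") of lengths $\lambda+r$, with independent $r$ uniform in $\{0,\dots,\lambda-1\}$; all short walks advance in parallel, one step per iteration, an iteration lasting until all its messages are delivered; then the destinations are sent back to the sources along the reversed paths. *Requests.* For a request $s$, a token starts at $s$. While the length completed is at most $\ell-2\lambda$, the node holding the token picks uniformly at random one of the short walks it initiated that is still unused, which thereby becomes used, and sends the token through the tree to the destination of that short walk; if it has no unused short walk left, the request fails. Finally the token performs the remaining steps as an ordinary random walk, one message per step. When a request fails, the phase ends, and a new phase starts with a new pre-processing and reruns the failed request. For a phase, observed until a request fails or until a given number $k$ of requests have been made in it, let $\kappa$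 be the fraction of its short walks that have been used, $K$ the number of walks completed in it, and $R$ and $M$ the total numbers of rounds and messages spent in it, including pre-processing, the failed request and, in the first phase, the set-up of the tree. The average numbers of rounds and messages per walk are $R/\max(K,1)$ and $M/\max(K,1)$. Suppose $\lambda=\tilde\Theta(\sqrt{\ell D})$, that is, $c_1\sqrt{\ell D}/(\log n)^a\le\lambda\le c_2\sqrt{\ell D}\,(\log n)^b$ for constants $c_1,c_2>0$ and integers $a,b\ge 0$. Then there are constants $C>0$ and $p\ge 0$, depending only on $c_1,c_2,a,b$, such that for every such $G$, $\ell$, $\lambda$, every rule for the sources, every choice of the root of the tree, every phase and every $k$: 1. If $2\lambda\le\ell$ and $k$ exceeds the number of short walks in the table, then the phase takes place and ends with a failed request. 2. With probability at least $1-2/n$: if the phase takes place and $\kappa>0$, then the average number of rounds per walk is at most $C(\log n)^p\left(\frac{\ell}{\kappa m}+\sqrt{\ell D}+D\right)$, that is, $\tilde O\left(\frac{\ell}{\kappa m}+\sqrt{\ell D}+D\right)$. 3. If moreover $\lambda\ge c_1\sqrt{\ell D}$, as for the algorithm's choice $\lambda=\lceil 24\sqrt{\ell D}(\log n)^3\rceil$,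 then always, if the phase takes place and $\kappa>0$, the average number of messages per walk is at most $C\left(\frac{\ell}{\kappa}+D\right)$, that is, $O\left(\frac{\ell}{\kappa}+D\right)$. -/

import Mathlib

/-! Continuous random walk sampling in a synchronous message-passing network. -/

namespace RWNet

noncomputable section

theorem nonempty_neighborSet {V : Type*} [Nontrivial V] {G : SimpleGraph V} (hG : G.Connected) (v : V) :
     Nonempty (G.neighborSet v) := by
  obtain ⟨w, hw⟩ := hG.preconnected.exists_adj_of_nontrivial v
  exact ⟨⟨w, hw⟩⟩

variable {V : Type*} [Fintype V] [DecidableEq V] [Nontrivial V]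
  (G : SimpleGraph V) [DecidableRel G.Adj]

/-! ### Rounds and messages -/

/-- A synchronous communication round, given by the set of darts (edges with a direction) on which
a message is sent. So a node sends at most one message over each incident edge in a round. A message
is a constant number of node identifiers and counters. -/
abbrev Round : Type _ := Finset G.Dart

variable {G}

/-- The number of messages sent in a sequence of rounds. -/
def messages (t : List (Round G)) : ℕ := (t.map Finset.card).sum

/-- Delivery of `load d` messages over each dart `d`, one per dart and round, all darts being used
in parallel; it takes as many rounds as the largest load. -/
def deliver (load : G.Dart → ℕ) : List (Round G) :=
  (List.range (Finset.univ.sup load)).map fun r => Finset.univ.filter fun d => r < load d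

/-- The same sequence of rounds, run backwards: every message travels back over its edge. -/
def backwards (t : List (Round G)) : List (Round G) :=
  (t.map fun R => R.image SimpleGraph.Dart.symm).reverse

variable (G)

/-! ### The breadth-first search tree -/

/-- The parent of `v` in a breadth-first search tree rooted at `root`. -/
def parent (root v : V) : V :=
  open Classical in
  if h : ∃ w, G.Adj v w ∧ G.dist root w + 1 = G.dist root v then h.choose else v

/-- Construction of the tree by flooding: the nodes at depth `i` send to all their neighbours in
round `i`. -/
def flood (root : V) : List (Round G) :=
  (List.range (G.diam + 1)).map fun i => Finset.univ.filter fun d => G.dist root d.fst = i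

/-- A convergecast: every node other than the root sends to its parent, deepest nodes first. -/
def convergecast (root : V) : List (Round G) :=
  (List.range (G.diam + 1)).map fun i =>
    Finset.univ.filter fun d => parent G root d.fst = d.snd ∧ G.dist root d.fst + i = G.diam

/-- One-time set-up of the tree: flooding, then one sweep up (sizes of subtrees) and one sweep down
(intervals of labels), after which messages can be routed along the tree to a given node. -/
def treeSetup (root : V) : List (Round G) :=
  flood G root ++ convergecast G root ++ backwards (convergecast G root)

/-- A message going up the tree for at most `f` steps, one edge per round. -/
def climb (root : V) : ℕ → V → List (Round G)
  | 0, _ => []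
  | f + 1, v =>
    if h : G.Adj v (parent G root v) then
      {SimpleGraph.Dart.mk (v, parent G root v) h} :: climb root f (parent G root v)
    else []

/-- A message routed along the tree from `v` to `w`: up to the root, then down. -/
def route (root v w : V) : List (Round G) :=
  climb G root (G.dist root v) v ++ backwards (climb G root (G.dist root w) w)

/-! ### Pre-processing: the table of short walks -/

/-- The number `η deg(v) log n` of short walks that `v` initiates, rounded up. -/
def numShort (η : ℝ) (v : V) : ℕ := ⌈η * G.degree v * Real.log (Fintype.card V)⌉₊

/-- The short walks: the `i`-th one of node `v`, for all `v` and `i`. -/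
abbrev Short (η : ℝ) : Type _ := Σ v : V, Fin (numShort G η v)

/-- A table holds the destination and the length of each short walk. -/
structure Table (η : ℝ) where
  dest : Short G η → V
  len : Short G η → ℕ

variable {G}

variable (hG : G.Connected) (η : ℝ) (lam : ℕ) [NeZero lam]

/-- A uniformly random neighbour. -/
def randomNeighbor (v : V) : PMF (G.neighborSet v) :=
  haveI := nonempty_neighborSet hG v
  PMF.uniformOfFintype (G.neighborSet v)

/-- Independent uniformly random neighbours of the current positions of all the short walks. -/
def randomNeighbors (pos : Short G η → V) : PMF (∀ j, G.neighborSet (pos j)) :=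
  haveI := fun j => nonempty_neighborSet hG (pos j)
  PMF.uniformOfFintype (∀ j, G.neighborSet (pos j))

/-- The first `i` iterations in which all short walks advance in parallel from their sources, each
one until it has reached its desired length. The result is their positions and the rounds used; an
iteration lasts until all its messages are delivered. -/
def advance (len : Short G η → ℕ) : ℕ → PMF ((Short G η → V) × List (Round G))
  | 0 => PMF.pure (fun j => j.1, [])
  | i + 1 => (advance len i).bind fun s => (randomNeighbors hG η s.1).bind fun next =>
      PMF.pure
        (fun j => if i < len j then (next j : V) else s.1 j,
         s.2 ++ deliver fun d => (Finset.univ.filter fun j =>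
            i < len j ∧ s.1 j = d.fst ∧ (next j : V) = d.snd).card)

/-- Pre-processing: the `j`-th short walk has length `lam + r j` with independent `r j`, uniform in
`{0, …, lam - 1}`. At the end the destinations are sent back along the reversed paths. -/
def preProcessing : PMF (Table G η × List (Round G)) :=
  (PMF.uniformOfFintype (Short G η → Fin lam)).bind fun r =>
    (advance hG η (fun j => lam + (r j : ℕ))
        (lam + Finset.univ.sup fun j => (r j : ℕ))).bind fun s =>
      PMF.pure (⟨s.1, fun j => lam + (r j : ℕ)⟩, s.2 ++ backwards s.2)

/-! ### A single random walk -/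

/-- The state while one walk is performed: the short walks still unused, the node holding the
token, the length completed, and the rounds used. -/
structure WalkState (G : SimpleGraph V) [DecidableRel G.Adj] (η : ℝ) where
  unused : Finset (Short G η)
  pos : V
  completed : ℕ
  rounds : List (Round G)

variable {η}

/-- Stitching: while the length completed is at most `ℓ - 2 * lam`, the node `v` holding the token
picks one of its unused short walks uniformly at random and sends the token to its destination. The
walk fails (`true` in the result) if `v` has no unused short walk left. The first argument bounds
the number of iterations; since short walks have length at least `1`, the value `ℓ` suffices. -/
def stitch (root : V) (T : Table G η) (ℓ : ℕ) :
    ℕ → WalkState G η → PMF (WalkState G η × Bool)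
  | 0, s => PMF.pure (s, false)
  | f + 1, s =>
    if s.completed + 2 * lam ≤ ℓ then
      if h : (s.unused.filter fun j => j.1 = s.pos).Nonempty then
        (PMF.uniformOfFinset (s.unused.filter fun j => j.1 = s.pos) h).bind fun j =>
          stitch root T ℓ f
            { unused := s.unused.erase j
              pos := T.dest j
              completed := s.completed + T.len j
              rounds := s.rounds ++ route G root s.pos (T.dest j) }
      else PMF.pure (s, true)
    else PMF.pure (s, false)

/-- The naive walk: the token is passed to a random neighbour, `t` times. -/
def naiveWalk : ℕ → V → PMF (V × List (Round G))
  | 0, v => PMF.pure (v, [])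
  | t + 1, v => (randomNeighbor hG v).bind fun u =>
      (naiveWalk t u).bind fun s =>
        PMF.pure (s.1, {SimpleGraph.Dart.mk (v, (u : V)) u.2} :: s.2)

/-- A single random walk of length `ℓ` from `s`: stitching, then a naive walk until `ℓ` steps are
completed. The result is the destination (`none` if the walk fails), the short walks unused
afterwards, and the rounds used. -/
def singleRandomWalk (root : V) (T : Table G η) (ℓ : ℕ) (unused : Finset (Short G η)) (s : V) :
    PMF (Option V × Finset (Short G η) × List (Round G)) :=
  (stitch lam root T ℓ ℓ ⟨unused, s, 0, []⟩).bind fun q =>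
    if q.2 then PMF.pure (none, q.1.unused, q.1.rounds)
    else (naiveWalk hG (ℓ - q.1.completed) q.1.pos).bind fun w =>
      PMF.pure (some w.1, q.1.unused, q.1.rounds ++ w.2)

/-! ### Continuous random walks -/

/-- The record of the use of one table: the short walks still unused, the number of walks of length
`ℓ` completed with this table, the rounds used (pre-processing included), the requests answered
since the start of the algorithm, as pairs of source and destination in order, and the source of the
request that failed, if there was one. -/
structure Phase (G : SimpleGraph V) [DecidableRel G.Adj] (η : ℝ) where
  unused : Finset (Short G η)
  completed : ℕ
  rounds : List (Round G)
  history : List (V × V)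
  failed : Option V

/-- The fraction of the short walks of the table that have been used. -/
def Phase.kappa (P : Phase G η) : ℝ :=
  ((Fintype.card (Short G η) - P.unused.card : ℝ)) / (Fintype.card (Short G η) : ℝ)

/-- Requests are answered until one fails, but at most `k` of them. The next source is drawn from
`src`, which may depend on all requests answered so far; a request pending from the previous table
comes first. -/
def serve (root : V) (T : Table G η) (ℓ : ℕ) (src : List (V × V) → PMF V) :
    ℕ → Option V → Phase G η → PMF (Phase G η)
  | 0, _, P => PMF.pure P
  | k + 1, pending, P =>
    (pending.elim (src P.history) PMF.pure).bind fun s =>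
      (singleRandomWalk hG lam root T ℓ P.unused s).bind fun o =>
        o.1.elim
          (PMF.pure
            { P with
              unused := o.2.1
              rounds := P.rounds ++ o.2.2
              failed := some s })
          fun v => serve root T ℓ src k none
            { P with
              unused := o.2.1
              completed := P.completed + 1
              rounds := P.rounds ++ o.2.2
              history := P.history ++ [(s, v)] }

variable (η)

/-- One phase: pre-processing, then requests until one fails, but at most `k` of them. -/
def phase (root : V) (ℓ : ℕ) (src : List (V × V) → PMF V) (k : ℕ) (setup : List (Round G))
    (history : List (V × V)) (pending : Option V) : PMF (Phase G η) :=
  (preProcessing hG η lam).bind fun p =>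
    serve hG lam root p.1 ℓ src k pending ⟨Finset.univ, 0, setup ++ p.2, history, none⟩

/-- The continuous random walk algorithm with `η = 1`: after the set-up of the tree, phases follow
one another, the request that failed in a phase being rerun in the next one. The value at `i` is the
record of the phase number `i` (counted from `0`), observed for at most `k` requests; it is `none`
if that phase is not reached because no request failed in an earlier one. -/
def continuousRandomWalk (root : V) (ℓ : ℕ) (src : List (V × V) → PMF V) (k : ℕ) :
    ℕ → PMF (Option (Phase G 1))
  | 0 => (phase hG 1 lam root ℓ src k (treeSetup G root) [] none).map some
  | i + 1 => (continuousRandomWalk root ℓ src k i).bind fun o =>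
      (o.bind fun P => P.failed.map fun s => (P.history, s)).elim (PMF.pure none) fun q =>
        (phase hG 1 lam root ℓ src k [] q.1 (some q.2)).map some

end

end RWNet

/-!
The analysis separates chance from bookkeeping. Only the number of rounds of the pre-processing has
to be controlled in probability; everything else holds for every outcome.

*Bookkeeping.* Let `N` be the number of short walks in a table, `d` the number of those used in a
phase and `c` the number of walks completed in it. A short walk has length at least `lam`, so a
request uses at most `ℓ / lam` of them, and `lam * d ≤ ℓ * (c + 1)`: with `κ = d / N` this bounds
the cost of the table per walk, since `N / max c 1 ≤ 2 * ℓ / (κ * lam)`. Routing costs at most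
`2 * diam` for each used short walk, the naive walk at the end at most `2 * lam` per completed walk
(`of_mem_support_serve`). Pre-processing sends at most `4 * lam * N` messages
(`of_mem_support_preProcessing`), and the set-up of the tree at most three per dart. Dividing by
`max c 1` gives `messages_per_walk_le`, and `rounds_per_walk_le` once pre-processing is known to take
`O(lam * log n)` rounds. If `2 * lam ≤ ℓ`, each completed walk uses a short walk, so more than `N`
requests cannot all succeed.

*Congestion.* Node `v` starts about `deg v * log n` short walks, and the degrees are stationary for
the random walk, so in every iteration the mean number of short walks crossing a given dart is at
most `log n + 1`. The short walks are independent (`mean_advance_prod`), whence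
`E[2 ^ load] ≤ exp (log n + 1) ≤ 3 * n` (`mean_two_pow_load_le`). An iteration takes as many rounds as
the largest load, which exceeds `A` by at most the sum of `2 ^ load / 2 ^ A` over the darts. The
number of iterations may be far larger than any power of `n`, so no union bound over the iterations
is available; instead the excess over `A` is summed over all iterations, and Markov's inequality is
applied to the sum (`mean_length_advance_le`, `advance_length_tail`). With `2 ^ A ≥ 2 * n ^ 4` the
failure probability is at most `2 / n`, and `A = O(log n)`.
-/

open scoped ENNReal
open Finset (univ range)

namespace RWNet

noncomputable section

set_option linter.unusedSectionVars false

/-! ### Means and probabilities -/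

/-- The mean of a nonnegative function under a discrete distribution. -/
def mean {α : Type*} (p : PMF α) (f : α → ℝ≥0∞) : ℝ≥0∞ := ∑' a, p a * f a

section Mean

variable {α β : Type*}

theorem mean_pure (a : α) (f : α → ℝ≥0∞) : mean (PMF.pure a) f = f a := by
  rw [mean, tsum_eq_single a]
  · simp
  · intro b hb
    simp [hb]

theorem mean_bind (p : PMF α) (q : α → PMF β) (f : β → ℝ≥0∞) :
    mean (p.bind q) f = mean p fun a => mean (q a) f := by
  simp only [mean, PMF.bind_apply, ← ENNReal.tsum_mul_right, ← ENNReal.tsum_mul_left, mul_assoc]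
  exact ENNReal.tsum_comm

theorem mean_mono (p : PMF α) {f g : α → ℝ≥0∞} (h : ∀ a, f a ≤ g a) : mean p f ≤ mean p g :=
  ENNReal.tsum_le_tsum fun a => mul_le_mul_right (h a) _

theorem mean_add (p : PMF α) (f g : α → ℝ≥0∞) :
    (mean p fun a => f a + g a) = mean p f + mean p g := by
  simp only [mean, mul_add, ENNReal.tsum_add]

theorem mean_const (p : PMF α) (c : ℝ≥0∞) : (mean p fun _ => c) = c := by
  rw [mean, ENNReal.tsum_mul_right, p.tsum_coe, one_mul]

theorem mean_sum {ι : Type*} (s : Finset ι) (p : PMF α) (f : ι → α → ℝ≥0∞) :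
    (mean p fun a => ∑ i ∈ s, f i a) = ∑ i ∈ s, mean p (f i) := by
  simp only [mean, Finset.mul_sum]
  exact Summable.tsum_finsetSum fun _ _ => ENNReal.summable

theorem mean_uniformOfFintype [Fintype α] [Nonempty α] (f : α → ℝ≥0∞) :
    mean (PMF.uniformOfFintype α) f = (Fintype.card α : ℝ≥0∞)⁻¹ * ∑ a, f a := by
  simp only [mean, PMF.uniformOfFintype_apply, tsum_fintype, Finset.mul_sum]

/-- Under the uniform distribution on a finite product the coordinates are independent. -/
theorem mean_uniformOfFintype_pi {ι : Type*} [Fintype ι] [DecidableEq ι] {κ : ι → Type*}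
    [∀ i, Fintype (κ i)] [∀ i, Nonempty (κ i)] (f : ∀ i, κ i → ℝ≥0∞) :
    (mean (PMF.uniformOfFintype (∀ i, κ i)) fun x => ∏ i, f i (x i)) =
      ∏ i, mean (PMF.uniformOfFintype (κ i)) (f i) := by
  simp only [mean_uniformOfFintype, Finset.prod_mul_distrib, Finset.prod_univ_sum,
    Fintype.piFinset_univ, Fintype.card_pi, Nat.cast_prod]
  rw [ENNReal.prod_inv_distrib]
  intro i _ j _ _
  simp

/-- Markov's inequality. -/
theorem toOuterMeasure_mul_le_mean (p : PMF α) (f : α → ℝ≥0∞) (c : ℝ≥0∞) (S : Set α)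
    (h : ∀ a ∈ S, c ≤ f a) : p.toOuterMeasure S * c ≤ mean p f := by
  rw [PMF.toOuterMeasure_apply, ← ENNReal.tsum_mul_right]
  refine ENNReal.tsum_le_tsum fun a => ?_
  by_cases ha : a ∈ S
  · simpa [ha] using mul_le_mul_right (h a ha) (p a)
  · simp [ha]

theorem toOuterMeasure_add_compl (p : PMF α) (S : Set α) :
    p.toOuterMeasure S + p.toOuterMeasure Sᶜ = 1 := by
  rw [PMF.toOuterMeasure_apply, PMF.toOuterMeasure_apply, ← ENNReal.tsum_add, ← p.tsum_coe]
  refine tsum_congr fun a => ?_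
  by_cases ha : a ∈ S <;> simp [ha]

theorem ofReal_one_sub_le_toOuterMeasure (p : PMF α) (S : Set α) {ε : ℝ} (hε : 0 ≤ ε)
    (h : p.toOuterMeasure Sᶜ ≤ ENNReal.ofReal ε) :
    ENNReal.ofReal (1 - ε) ≤ p.toOuterMeasure S := by
  rw [ENNReal.ofReal_sub _ hε, ENNReal.ofReal_one, tsub_le_iff_right,
    ← toOuterMeasure_add_compl p S]
  gcongr

theorem toOuterMeasure_eq_one_of_support_subset (p : PMF α) {S : Set α} (h : p.support ⊆ S) :
    p.toOuterMeasure S = 1 :=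
  (p.toOuterMeasure_apply_eq_one_iff S).2 h

theorem le_toOuterMeasure_bind (p : PMF α) (q : α → PMF β) (S : Set β) (c : ℝ≥0∞)
    (h : ∀ a ∈ p.support, c ≤ (q a).toOuterMeasure S) : c ≤ (p.bind q).toOuterMeasure S := by
  rw [PMF.toOuterMeasure_bind_apply, ← one_mul c, ← p.tsum_coe, ← ENNReal.tsum_mul_right]
  refine ENNReal.tsum_le_tsum fun a => ?_
  by_cases ha : p a = 0
  · simp [ha]
  · exact mul_le_mul_right (h a ((p.mem_support_iff a).2 ha)) _

/-- An event that is certain after a good first stage is at least as likely as the latter. -/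
theorem toOuterMeasure_le_toOuterMeasure_bind (p : PMF α) (q : α → PMF β) (S : Set α) (S' : Set β)
    (h : ∀ a ∈ p.support, a ∈ S → (q a).support ⊆ S') :
    p.toOuterMeasure S ≤ (p.bind q).toOuterMeasure S' := by
  rw [PMF.toOuterMeasure_bind_apply, PMF.toOuterMeasure_apply]
  refine ENNReal.tsum_le_tsum fun a => ?_
  by_cases ha : p a = 0
  · simp [Set.indicator, ha]
  by_cases haS : a ∈ S
  · rw [toOuterMeasure_eq_one_of_support_subset _ (h a ((p.mem_support_iff a).2 ha) haS)]
    simp [haS]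
  · simp [haS]

theorem prod_one_add_le_exp {ι : Type*} (s : Finset ι) (x : ι → ℝ≥0∞) {c : ℝ}
    (hc : 0 ≤ c) (h : ∑ i ∈ s, x i ≤ ENNReal.ofReal c) :
    ∏ i ∈ s, (1 + x i) ≤ ENNReal.ofReal (Real.exp c) := by
  have hx : ∀ i ∈ s, x i ≠ ∞ := fun i hi =>
    ne_top_of_le_ne_top ENNReal.ofReal_ne_top ((Finset.single_le_sum (by simp) hi).trans h)
  have h1 : ∀ i ∈ s, 1 + x i ≤ ENNReal.ofReal (Real.exp (x i).toReal) := by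
    intro i hi
    rw [← ENNReal.ofReal_toReal (hx i hi), ← ENNReal.ofReal_one,
      ← ENNReal.ofReal_add zero_le_one ENNReal.toReal_nonneg,
      ENNReal.toReal_ofReal ENNReal.toReal_nonneg]
    exact ENNReal.ofReal_le_ofReal (by linarith [Real.add_one_le_exp (x i).toReal])
  refine (Finset.prod_le_prod' h1).trans ?_
  rw [← ENNReal.ofReal_prod_of_nonneg fun _ _ => (Real.exp_pos _).le, ← Real.exp_sum,
    ← ENNReal.toReal_sum hx]
  exact ENNReal.ofReal_le_ofReal (Real.exp_le_exp.2 (ENNReal.toReal_le_of_le_ofReal hc h))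

end Mean

variable {V : Type*} [Fintype V] [DecidableEq V] [Nontrivial V]
  {G : SimpleGraph V} [DecidableRel G.Adj]

/-! ### The joint law of the short walks -/

/-- The transition operator of the simple random walk: the average of `f` over the neighbours. -/
def neighborAvg (hG : G.Connected) (f : V → ℝ≥0∞) (v : V) : ℝ≥0∞ :=
  mean (randomNeighbor hG v) fun w => f w

theorem mean_randomNeighbors (hG : G.Connected) (η : ℝ) (pos : Short G η → V)
    (f : ∀ j, G.neighborSet (pos j) → ℝ≥0∞) :
    (mean (randomNeighbors hG η pos) fun x => ∏ j, f j (x j)) =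
      ∏ j, mean (randomNeighbor hG (pos j)) (f j) := by
  have := fun j => nonempty_neighborSet hG (pos j)
  exact mean_uniformOfFintype_pi f

/-- The short walks are independent, and after `i` iterations a walk of desired length `len j` has
made `min i (len j)` steps. -/
theorem mean_advance_prod (hG : G.Connected) (η : ℝ) (len : Short G η → ℕ) (i : ℕ)
    (f : Short G η → V → ℝ≥0∞) :
    (mean (advance hG η len i) fun s => ∏ j, f j (s.1 j)) =
      ∏ j, (neighborAvg hG)^[min i (len j)] (f j) j.1 := by
  induction i generalizing f with
  | zero => simp [advance, mean_pure]
  | succ i ih =>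
    have h : ∀ s : (Short G η → V) × List (Round G),
        (mean (randomNeighbors hG η s.1) fun next =>
          ∏ j, f j (if i < len j then (next j : V) else s.1 j)) =
        ∏ j, (if i < len j then neighborAvg hG (f j) else f j) (s.1 j) := by
      intro s
      rw [mean_randomNeighbors hG η s.1
        (fun j w => f j (if i < len j then (w : V) else s.1 j))]
      refine Finset.prod_congr rfl fun j _ => ?_
      by_cases hj : i < len j
      · simp [hj, neighborAvg]
      · simp [hj, mean_const]
    simp only [advance, mean_bind, mean_pure, h]
    rw [ih fun j => if i < len j then neighborAvg hG (f j) else f j]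
    refine Finset.prod_congr rfl fun j _ => ?_
    by_cases hj : i < len j
    · rw [if_pos hj, min_eq_left hj.le, min_eq_left hj, Function.iterate_succ_apply]
    · rw [if_neg hj, min_eq_right (not_lt.1 hj), min_eq_right (by omega)]

theorem neighborAvg_eq (hG : G.Connected) (f : V → ℝ≥0∞) (v : V) :
    neighborAvg hG f v = (G.degree v : ℝ≥0∞)⁻¹ * ∑ w ∈ G.neighborFinset v, f w := by
  have := nonempty_neighborSet hG v
  rw [neighborAvg, randomNeighbor, mean_uniformOfFintype, SimpleGraph.card_neighborSet_eq_degree,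
    Finset.sum_subtype (G.neighborFinset v) (p := fun w => w ∈ G.neighborSet v) (fun w => by simp)]

theorem neighborAvg_one_add (hG : G.Connected) (f : V → ℝ≥0∞) :
    (neighborAvg hG fun v => 1 + f v) = fun v => 1 + neighborAvg hG f v := by
  funext v
  simp only [neighborAvg, mean_add, mean_const]

theorem iterate_neighborAvg_one_add (hG : G.Connected) (i : ℕ) (f : V → ℝ≥0∞) :
    ((neighborAvg hG)^[i] fun v => 1 + f v) = fun v => 1 + (neighborAvg hG)^[i] f v := by
  induction i generalizing f with
  | zero => rfl
  | succ i ih => simp only [Function.iterate_succ_apply, neighborAvg_one_add, ih]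

theorem degree_ne_zero (hG : G.Connected) (v : V) : G.degree v ≠ 0 :=
  (hG.preconnected.degree_pos_of_nontrivial v).ne'

/-- The degrees form a stationary measure of the simple random walk. -/
theorem sum_degree_mul_neighborAvg (hG : G.Connected) (f : V → ℝ≥0∞) :
    ∑ v, G.degree v * neighborAvg hG f v = ∑ v, G.degree v * f v := by
  have h : ∀ v, G.degree v * neighborAvg hG f v = ∑ w ∈ G.neighborFinset v, f w := by
    intro v
    rw [neighborAvg_eq, ← mul_assoc, ENNReal.mul_inv_cancel
      (by exact_mod_cast degree_ne_zero hG v) (ENNReal.natCast_ne_top _), one_mul]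
  simp only [h]
  rw [Finset.sum_comm' (t' := univ) (s' := fun w => G.neighborFinset w)]
  · simp
  · intro v w
    simp [G.adj_comm]

theorem sum_degree_mul_iterate_neighborAvg (hG : G.Connected) (i : ℕ) (f : V → ℝ≥0∞) :
    ∑ v, G.degree v * (neighborAvg hG)^[i] f v = ∑ v, G.degree v * f v := by
  induction i generalizing f with
  | zero => rfl
  | succ i ih => rw [Function.iterate_succ_apply, ih, sum_degree_mul_neighborAvg]

/-! ### Congestion in the pre-processing -/

/-- The number of short walks that cross the dart `d` in iteration `i`. -/
def load {η : ℝ} (len : Short G η → ℕ) (i : ℕ) (pos : Short G η → V)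
    (next : ∀ j, G.neighborSet (pos j)) (d : G.Dart) : ℕ :=
  (univ.filter fun j => i < len j ∧ pos j = d.fst ∧ (next j : V) = d.snd).card

theorem two_pow_card_filter {ι : Type*} (s : Finset ι) (p : ι → Prop) [DecidablePred p] :
    (2 : ℝ≥0∞) ^ (s.filter p).card = ∏ j ∈ s, if p j then 2 else 1 := by
  rw [Finset.prod_ite]
  simp

theorem mean_randomNeighbor_ite_le (hG : G.Connected) (d : G.Dart) (v : V) :
    (mean (randomNeighbor hG v) fun w => if v = d.fst ∧ (w : V) = d.snd then 2 else 1) ≤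
      1 + if v = d.fst then (G.degree d.fst : ℝ≥0∞)⁻¹ else 0 := by
  have h : ∀ w : G.neighborSet v, (if v = d.fst ∧ (w : V) = d.snd then (2 : ℝ≥0∞) else 1) =
      1 + if v = d.fst then (if (w : V) = d.snd then 1 else 0) else 0 := by
    intro w
    by_cases h1 : v = d.fst <;> by_cases h2 : (w : V) = d.snd <;> simp [h1, h2, one_add_one_eq_two]
  simp only [h, mean_add, mean_const]
  gcongr
  by_cases hv : v = d.fst
  · subst hv
    simp only [if_true]
    have := neighborAvg_eq hG (fun w => if w = d.snd then 1 else 0) d.fst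
    rw [neighborAvg] at this
    rw [this]
    have hs := d.adj
    simp [Finset.sum_ite_eq', hs]
  · simp [hv, mean_const]

theorem numShort_le (G : SimpleGraph V) [DecidableRel G.Adj] (hG : G.Connected) (v : V) :
    (numShort G 1 v : ℝ) ≤ (Real.log (Fintype.card V) + 1) * G.degree v := by
  have h1 : (1 : ℝ) ≤ G.degree v := by
    exact_mod_cast Nat.one_le_iff_ne_zero.2 (degree_ne_zero hG v)
  have h2 : 0 ≤ Real.log (Fintype.card V) := Real.log_natCast_nonneg _
  have := (Nat.ceil_lt_add_one (a := 1 * G.degree v * Real.log (Fintype.card V)) (by positivity)).le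
  rw [numShort]
  nlinarith

/-- The exponential moment of the congestion. Since the walks start with a density of at most
`log n + 1` with respect to the stationary measure, the mean load of a dart is at most `log n + 1`
in every iteration. -/
theorem mean_two_pow_load_le (hG : G.Connected) (len : Short G 1 → ℕ) (i : ℕ) (d : G.Dart) :
    (mean (advance hG 1 len i) fun s =>
      mean (randomNeighbors hG 1 s.1) fun next => 2 ^ load len i s.1 next d) ≤
      3 * Fintype.card V := by
  set x : V → ℝ≥0∞ := fun v => if v = d.fst then (G.degree d.fst : ℝ≥0∞)⁻¹ else 0 with hx
  have step : ∀ s : (Short G 1 → V) × List (Round G),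
      (mean (randomNeighbors hG 1 s.1) fun next => 2 ^ load len i s.1 next d) ≤
        ∏ j, (if i < len j then fun v => 1 + x v else fun _ => 1 + 0) (s.1 j) := by
    intro s
    simp only [load, two_pow_card_filter]
    rw [mean_randomNeighbors hG 1 s.1
      (fun j w => if i < len j ∧ s.1 j = d.fst ∧ (w : V) = d.snd then 2 else 1)]
    refine Finset.prod_le_prod' fun j _ => ?_
    by_cases hj : i < len j
    · simpa [hj] using mean_randomNeighbor_ite_le hG d (s.1 j)
    · simp [hj, mean_const]
  refine (mean_mono _ step).trans ?_
  rw [mean_advance_prod hG 1 len i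
    (fun j => if i < len j then fun v => 1 + x v else fun _ => 1 + 0)]
  have hL : 0 ≤ Real.log (Fintype.card V) := Real.log_natCast_nonneg _
  have hfac : ∀ j ∈ (univ : Finset (Short G 1)), (neighborAvg hG)^[min i (len j)]
      (if i < len j then fun v => 1 + x v else fun _ => 1 + 0) j.1 ≤
      1 + (neighborAvg hG)^[i] x j.1 := by
    intro j _
    by_cases hj : i < len j
    · rw [if_pos hj, min_eq_left hj.le, iterate_neighborAvg_one_add]
    · have h0 : ∀ t, (neighborAvg hG)^[t] (fun _ => (1 + 0 : ℝ≥0∞)) = fun _ => 1 := by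
        intro t
        induction t with
        | zero => simp
        | succ t ih =>
          rw [Function.iterate_succ_apply', ih]
          funext v
          simp [neighborAvg, mean_const]
      rw [if_neg hj, h0]
      exact le_self_add
  refine (Finset.prod_le_prod' hfac).trans ?_
  refine (prod_one_add_le_exp _ _ (c := Real.log (Fintype.card V) + 1) (by linarith) ?_).trans ?_
  · rw [Fintype.sum_sigma]
    simp only [Finset.sum_const, Finset.card_univ, Fintype.card_fin, nsmul_eq_mul]
    have hn : ∀ v, (numShort G 1 v : ℝ≥0∞) ≤
        ENNReal.ofReal (Real.log (Fintype.card V) + 1) * G.degree v := by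
      intro v
      rw [← ENNReal.ofReal_natCast, ← ENNReal.ofReal_natCast,
        ← ENNReal.ofReal_mul (by linarith)]
      exact ENNReal.ofReal_le_ofReal (numShort_le G hG v)
    calc ∑ v, (numShort G 1 v : ℝ≥0∞) * (neighborAvg hG)^[i] x v
        ≤ ∑ v, ENNReal.ofReal (Real.log (Fintype.card V) + 1) *
            (G.degree v * (neighborAvg hG)^[i] x v) :=
          Finset.sum_le_sum fun v _ => by
            rw [← mul_assoc]
            exact mul_le_mul_left (hn v) _
      _ = ENNReal.ofReal (Real.log (Fintype.card V) + 1) := by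
          rw [← Finset.mul_sum, sum_degree_mul_iterate_neighborAvg]
          simp only [hx, mul_ite, mul_zero, Finset.sum_ite_eq', Finset.mem_univ, if_true]
          rw [ENNReal.mul_inv_cancel (by exact_mod_cast degree_ne_zero hG _)
            (ENNReal.natCast_ne_top _), mul_one]
  · rw [Real.exp_add, Real.exp_log (by exact_mod_cast Fintype.card_pos), mul_comm,
      ENNReal.ofReal_mul (Real.exp_pos _).le, ENNReal.ofReal_natCast]
    gcongr
    rw [← ENNReal.ofReal_ofNat]
    exact ENNReal.ofReal_le_ofReal (by linarith [Real.exp_one_lt_d9])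

theorem length_deliver (ld : G.Dart → ℕ) : (deliver ld).length = univ.sup ld := by
  simp [deliver]

theorem two_pow_mul_sub_le (A x : ℕ) : 2 ^ A * (x - A) ≤ 2 ^ x := by
  rcases le_total x A with h | h
  · simp [Nat.sub_eq_zero_of_le h]
  · obtain ⟨y, rfl⟩ := Nat.exists_eq_add_of_le h
    rw [Nat.add_sub_cancel_left, pow_add]
    exact Nat.mul_le_mul_left _ Nat.lt_two_pow_self.le

theorem two_pow_mul_sup_sub_le {ι : Type*} (s : Finset ι) (A : ℕ) (f : ι → ℕ) :
    2 ^ A * (s.sup f - A) ≤ ∑ d ∈ s, 2 ^ f d := by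
  rcases s.eq_empty_or_nonempty with rfl | hs
  · simp
  · obtain ⟨d, hd, he⟩ := Finset.exists_mem_eq_sup s hs f
    rw [he]
    exact (two_pow_mul_sub_le A (f d)).trans
      (Finset.single_le_sum (f := fun d => 2 ^ f d) (fun _ _ => Nat.zero_le _) hd)

/-- The excess of the number of rounds over `A` per iteration, scaled by `2 ^ A`, is small in the
mean. The subtraction is truncated, which makes the excess subadditive over the iterations. -/
theorem mean_length_advance_le (hG : G.Connected) (len : Short G 1 → ℕ) (A i : ℕ) :
    (mean (advance hG 1 len i) fun s => ((2 ^ A * (s.2.length - A * i) : ℕ) : ℝ≥0∞)) ≤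
      i * (Fintype.card G.Dart * (3 * Fintype.card V)) := by
  induction i with
  | zero => simp [advance, mean_pure]
  | succ i ih =>
    simp only [advance, mean_bind, mean_pure, List.length_append, length_deliver]
    have step : ∀ (s : (Short G 1 → V) × List (Round G)) (next : ∀ j, G.neighborSet (s.1 j)),
        ((2 ^ A * (s.2.length + univ.sup (load len i s.1 next) - A * (i + 1)) : ℕ) : ℝ≥0∞) ≤
          ((2 ^ A * (s.2.length - A * i) : ℕ) : ℝ≥0∞) + ∑ d, 2 ^ load len i s.1 next d := by
      intro s next
      have h := two_pow_mul_sup_sub_le univ A (load len i s.1 next)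
      have h' : s.2.length + univ.sup (load len i s.1 next) - A * (i + 1) ≤
          (s.2.length - A * i) + (univ.sup (load len i s.1 next) - A) := by
        rw [mul_add]
        omega
      have := (Nat.mul_le_mul_left (2 ^ A) h').trans
        ((mul_add _ _ _).le.trans (Nat.add_le_add_left h _))
      exact_mod_cast this
    refine (mean_mono _ fun s => mean_mono _ fun next => step s next).trans ?_
    simp only [mean_add, mean_const, mean_sum]
    push_cast
    rw [add_mul, one_mul]
    refine add_le_add (by simpa using ih) ?_
    refine (Finset.sum_le_sum fun d _ => mean_two_pow_load_le hG len i d).trans ?_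
    simp

theorem card_dart_le (G : SimpleGraph V) [DecidableRel G.Adj] :
    Fintype.card G.Dart ≤ Fintype.card V ^ 2 := by
  rw [sq, ← Fintype.card_prod]
  exact Fintype.card_le_of_injective _ SimpleGraph.Dart.toProd_injective

/-- Apart from an event of probability `2 / n`, the excess over `A` per iteration adds up to at most
one round per iteration. -/
theorem advance_length_tail (hG : G.Connected) (len : Short G 1 → ℕ) (A i : ℕ)
    (hA : 2 * Fintype.card V ^ 4 ≤ 2 ^ A) (hi : 0 < i) :
    ENNReal.ofReal (1 - 2 / (Fintype.card V : ℝ)) ≤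
      (advance hG 1 len i).toOuterMeasure {s | s.2.length ≤ i * (A + 1)} := by
  have hn : 0 < Fintype.card V := Fintype.card_pos
  refine ofReal_one_sub_le_toOuterMeasure _ _ (by positivity) ?_
  have hm := (toOuterMeasure_mul_le_mean (advance hG 1 len i) _ ((2 ^ A * i : ℕ) : ℝ≥0∞)
    {s | s.2.length ≤ i * (A + 1)}ᶜ (fun s hs => by
      simp only [Set.mem_compl_iff, Set.mem_ofPred_eq, not_le] at hs
      have : i ≤ s.2.length - A * i := by
        have : i * (A + 1) = A * i + i := by ring
        omega
      exact_mod_cast Nat.mul_le_mul_left (2 ^ A) this)).trans (mean_length_advance_le hG len A i)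
  have hc : ((2 ^ A * i : ℕ) : ℝ≥0∞) ≠ 0 := by
    exact_mod_cast (by positivity : 2 ^ A * i ≠ 0)
  rw [← ENNReal.le_div_iff_mul_le (Or.inl hc) (Or.inl (ENNReal.natCast_ne_top _))] at hm
  refine hm.trans ?_
  have key : i * (Fintype.card G.Dart * (3 * Fintype.card V)) * Fintype.card V ≤
      2 * (2 ^ A * i) := by
    calc i * (Fintype.card G.Dart * (3 * Fintype.card V)) * Fintype.card V
        ≤ i * (Fintype.card V ^ 2 * (3 * Fintype.card V)) * Fintype.card V := by
          gcongr
          exact card_dart_le G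
      _ = i * (3 * Fintype.card V ^ 4) := by ring
      _ ≤ i * (2 * (2 * Fintype.card V ^ 4)) := Nat.mul_le_mul_left _ (by omega)
      _ ≤ i * (2 * 2 ^ A) := by gcongr
      _ = 2 * (2 ^ A * i) := by ring
  rw [ENNReal.div_le_iff hc (ENNReal.natCast_ne_top _), ENNReal.ofReal_div_of_pos (by positivity),
    ENNReal.ofReal_ofNat, ENNReal.ofReal_natCast, ← ENNReal.mul_div_right_comm,
    ENNReal.le_div_iff_mul_le (Or.inl (by simp)) (Or.inl (ENNReal.natCast_ne_top _))]
  exact_mod_cast key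

theorem length_backwards (t : List (Round G)) : (backwards t).length = t.length := by
  simp [backwards]

/-- With high probability the pre-processing takes `O(lam * A)` rounds. -/
theorem preProcessing_length_tail (hG : G.Connected) (lam : ℕ) [NeZero lam] (A : ℕ)
    (hA : 2 * Fintype.card V ^ 4 ≤ 2 ^ A) :
    ENNReal.ofReal (1 - 2 / (Fintype.card V : ℝ)) ≤
      (preProcessing hG 1 lam).toOuterMeasure {p | p.2.length ≤ 4 * lam * (A + 1)} := by
  have hlam : 0 < lam := Nat.pos_of_ne_zero (NeZero.ne lam)
  refine le_toOuterMeasure_bind _ _ _ _ fun r _ => ?_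
  refine (advance_length_tail hG _ A _ hA (by omega)).trans
    (toOuterMeasure_le_toOuterMeasure_bind _ _ _ _ fun s _ hs => ?_)
  intro p hp
  rw [PMF.support_pure, Set.mem_singleton_iff] at hp
  subst hp
  have hr : (univ.sup fun j => (r j : ℕ)) ≤ lam := Finset.sup_le fun j _ => (r j).2.le
  simp only [Set.mem_ofPred_eq, List.length_append, length_backwards] at hs ⊢
  have : (lam + univ.sup fun j => (r j : ℕ)) * (A + 1) ≤ (2 * lam) * (A + 1) := by
    gcongr
    omega
  nlinarith

/-! ### Rounds and messages of the building blocks -/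

theorem messages_append (s t : List (Round G)) : messages (s ++ t) = messages s + messages t := by
  simp [messages]

theorem messages_cons (R : Round G) (t : List (Round G)) :
    messages (R :: t) = R.card + messages t := by
  simp [messages]

theorem messages_nil : messages ([] : List (Round G)) = 0 := rfl

theorem messages_backwards (t : List (Round G)) : messages (backwards t) = messages t := by
  have h : ∀ R : Round G, (R.image SimpleGraph.Dart.symm).card = R.card := fun R =>
    Finset.card_image_of_injective _ SimpleGraph.Dart.symm_involutive.injective
  simp [messages, backwards, Function.comp_def, h]

theorem messages_map_range (k : ℕ) (p : ℕ → G.Dart → Prop) [∀ i, DecidablePred (p i)] :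
    messages ((List.range k).map fun i => univ.filter (p i)) =
      ∑ d : G.Dart, ((range k).filter fun i => p i d).card := by
  have h : messages ((List.range k).map fun i => univ.filter (p i)) =
      ∑ i ∈ range k, (univ.filter (p i)).card := by
    induction k with
    | zero => simp [messages]
    | succ k ih => rw [List.range_succ, List.map_append, messages_append, ih,
        Finset.sum_range_succ]; simp [messages]
  simp only [h, Finset.card_filter]
  exact Finset.sum_comm

theorem messages_deliver (ld : G.Dart → ℕ) : messages (deliver ld) = ∑ d, ld d := by
  rw [deliver, messages_map_range _ fun r d => r < ld d]
  refine Finset.sum_congr rfl fun d _ => ?_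
  have h : ((range (univ.sup ld)).filter fun r => r < ld d) = range (ld d) := by
    ext r
    have := Finset.le_sup (f := ld) (Finset.mem_univ d)
    simp only [Finset.mem_filter, Finset.mem_range]
    omega
  rw [h, Finset.card_range]

theorem messages_flood_le (root : V) : messages (flood G root) ≤ Fintype.card G.Dart := by
  rw [flood, messages_map_range _ fun i (d : G.Dart) => G.dist root d.fst = i,
    ← Finset.card_univ, Finset.card_eq_sum_ones]
  refine Finset.sum_le_sum fun d _ => Finset.card_le_one.2 fun i hi j hj => ?_
  simp only [Finset.mem_filter] at hi hj
  omega

theorem messages_convergecast_le (root : V) :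
    messages (convergecast G root) ≤ Fintype.card G.Dart := by
  rw [convergecast, messages_map_range _ fun i (d : G.Dart) =>
      parent G root d.fst = d.snd ∧ G.dist root d.fst + i = G.diam,
    ← Finset.card_univ, Finset.card_eq_sum_ones]
  refine Finset.sum_le_sum fun d _ => Finset.card_le_one.2 fun i hi j hj => ?_
  simp only [Finset.mem_filter] at hi hj
  omega

theorem messages_treeSetup_le (root : V) : messages (treeSetup G root) ≤ 3 * Fintype.card G.Dart := by
  have h1 := messages_flood_le (G := G) root
  have h2 := messages_convergecast_le (G := G) root
  rw [treeSetup, messages_append, messages_append, messages_backwards]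
  omega

theorem length_treeSetup (root : V) : (treeSetup G root).length = 3 * (G.diam + 1) := by
  simp [treeSetup, flood, convergecast, backwards]
  ring

theorem length_climb_le (root : V) (f : ℕ) (v : V) : (climb G root f v).length ≤ f := by
  induction f generalizing v with
  | zero => simp [climb]
  | succ f ih =>
    rw [climb]
    split
    · simpa using ih _
    · simp

theorem messages_climb (root : V) (f : ℕ) (v : V) :
    messages (climb G root f v) = (climb G root f v).length := by
  induction f generalizing v with
  | zero => simp [climb, messages_nil]
  | succ f ih =>
    rw [climb]
    split
    · rw [messages_cons, ih, List.length_cons, Finset.card_singleton, add_comm]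
    · simp [messages_nil]

theorem dist_le_diam (hG : G.Connected) (u v : V) : G.dist u v ≤ G.diam :=
  SimpleGraph.dist_le_diam (SimpleGraph.connected_iff_ediam_ne_top.1 hG)

theorem length_route_le (hG : G.Connected) (root v w : V) :
    (route G root v w).length ≤ 2 * G.diam := by
  have h1 := (length_climb_le (G := G) root _ v).trans (dist_le_diam hG root v)
  have h2 := (length_climb_le (G := G) root _ w).trans (dist_le_diam hG root w)
  rw [route, List.length_append, length_backwards]
  omega

theorem messages_route (root v w : V) :
    messages (route G root v w) = (route G root v w).length := by
  rw [route, messages_append, messages_backwards, messages_climb, messages_climb,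
    List.length_append, length_backwards]

/-! ### The cost of pre-processing -/

theorem messages_of_mem_support_advance (hG : G.Connected) {η : ℝ} (len : Short G η → ℕ) (i : ℕ)
    {s : (Short G η → V) × List (Round G)} (hs : s ∈ (advance hG η len i).support) :
    messages s.2 ≤ i * Fintype.card (Short G η) := by
  induction i generalizing s with
  | zero =>
    rw [advance, PMF.support_pure, Set.mem_singleton_iff] at hs
    simp [hs, messages_nil]
  | succ i ih =>
    simp only [advance, PMF.mem_support_bind_iff, PMF.support_pure, Set.mem_singleton_iff] at hs
    obtain ⟨s₀, hs₀, next, -, rfl⟩ := hs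
    rw [messages_append, messages_deliver, add_mul, one_mul]
    refine add_le_add (ih hs₀) ?_
    -- a short walk crosses at most one dart in an iteration
    rw [← Finset.card_univ, Finset.card_eq_sum_ones]
    simp only [Finset.card_filter]
    rw [Finset.sum_comm]
    refine Finset.sum_le_sum fun j _ => ?_
    rw [← Finset.card_filter]
    refine Finset.card_le_one.2 fun d hd e he => ?_
    simp only [Finset.mem_filter] at hd he
    exact SimpleGraph.Dart.ext _ _ (Prod.ext (hd.2.2.1.symm.trans he.2.2.1)
      (hd.2.2.2.symm.trans he.2.2.2))

theorem of_mem_support_preProcessing (hG : G.Connected) {η : ℝ} (lam : ℕ) [NeZero lam]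
    {p : Table G η × List (Round G)} (hp : p ∈ (preProcessing hG η lam).support) :
    (∀ j, lam ≤ p.1.len j ∧ p.1.len j ≤ 2 * lam) ∧
      messages p.2 ≤ 4 * lam * Fintype.card (Short G η) := by
  simp only [preProcessing, PMF.mem_support_bind_iff, PMF.support_pure,
    Set.mem_singleton_iff] at hp
  obtain ⟨r, -, s, hs, rfl⟩ := hp
  refine ⟨fun j => ⟨Nat.le_add_right _ _, ?_⟩, ?_⟩
  · have := (r j).2
    simp only
    omega
  · have h := messages_of_mem_support_advance hG _ _ hs
    have hr : (univ.sup fun j => (r j : ℕ)) ≤ lam := Finset.sup_le fun j _ => (r j).2.le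
    have h2 : (lam + univ.sup fun j => (r j : ℕ)) * Fintype.card (Short G η) ≤
        (2 * lam) * Fintype.card (Short G η) := by
      gcongr
      omega
    rw [messages_append, messages_backwards]
    linarith

/-! ### The cost of the requests -/

/-- Stitching that uses `d` short walks covers a length of at least `lam * d` at a cost of at most
`2 * diam` rounds for each of them, and unless it fails at most `2 * lam` steps are left. -/
theorem of_mem_support_stitch (hG : G.Connected) {η : ℝ} {lam : ℕ} (hlam : 0 < lam) (root : V)
    {T : Table G η} (hT : ∀ j, lam ≤ T.len j ∧ T.len j ≤ 2 * lam) {ℓ : ℕ} (f : ℕ)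
    {s : WalkState G η} {q : WalkState G η × Bool} (hq : q ∈ (stitch lam root T ℓ f s).support)
    (hs : s.completed ≤ ℓ) (hf : ℓ ≤ s.completed + f) :
    ∃ (d : ℕ) (t : List (Round G)),
      s.unused.card = q.1.unused.card + d ∧ q.1.rounds = s.rounds ++ t ∧
      t.length ≤ 2 * G.diam * d ∧ messages t = t.length ∧
      s.completed + lam * d ≤ q.1.completed ∧ q.1.completed ≤ ℓ ∧
      (q.2 = false → ℓ ≤ q.1.completed + 2 * lam) ∧
      (q.2 = false → s.completed + 2 * lam ≤ ℓ → 0 < d) := by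
  induction f generalizing s with
  | zero =>
    rw [stitch, PMF.support_pure, Set.mem_singleton_iff] at hq
    subst hq
    exact ⟨0, [], by simp, by simp, by simp, rfl, by simp, hs, fun _ => by simp only; omega,
      fun _ h => by omega⟩
  | succ f ih =>
    rw [stitch] at hq
    split_ifs at hq with hc h
    · rw [PMF.mem_support_bind_iff] at hq
      obtain ⟨j, hj, hq⟩ := hq
      rw [PMF.mem_support_uniformOfFinset_iff, Finset.mem_filter] at hj
      have hTj := hT j
      obtain ⟨d, t, h1, h2, h3, h4, h5, h6, h7, -⟩ := ih hq (by simp only; omega)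
        (by simp only; omega)
      simp only at h1 h2 h5
      have hcard := Finset.card_erase_add_one hj.1
      have hr := length_route_le hG root s.pos (T.dest j)
      refine ⟨d + 1, route G root s.pos (T.dest j) ++ t, by omega, ?_, ?_, ?_, ?_, h6, h7,
        fun _ _ => Nat.succ_pos d⟩
      · rw [h2, List.append_assoc]
      · rw [List.length_append, mul_add, mul_one]
        omega
      · rw [messages_append, messages_route, h4, List.length_append]
      · rw [mul_add, mul_one]
        omega
    · rw [PMF.support_pure, Set.mem_singleton_iff] at hq
      subst hq
      exact ⟨0, [], by simp, by simp, by simp, rfl, by simp, hs, by simp, by simp⟩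
    · rw [PMF.support_pure, Set.mem_singleton_iff] at hq
      subst hq
      exact ⟨0, [], by simp, by simp, by simp, rfl, by simp, hs, fun _ => by simp only; omega,
        fun _ h => absurd h hc⟩

theorem of_mem_support_naiveWalk (hG : G.Connected) (t : ℕ) {v : V} {w : V × List (Round G)}
    (hw : w ∈ (naiveWalk hG t v).support) : w.2.length = t ∧ messages w.2 = t := by
  induction t generalizing v w with
  | zero =>
    rw [naiveWalk, PMF.support_pure, Set.mem_singleton_iff] at hw
    simp [hw, messages_nil]
  | succ t ih =>
    simp only [naiveWalk, PMF.mem_support_bind_iff, PMF.support_pure,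
      Set.mem_singleton_iff] at hw
    obtain ⟨u, -, s, hs, rfl⟩ := hw
    obtain ⟨h1, h2⟩ := ih hs
    rw [messages_cons, Finset.card_singleton, h2, List.length_cons, h1]
    exact ⟨rfl, add_comm _ _⟩

theorem of_mem_support_singleRandomWalk (hG : G.Connected) {η : ℝ} {lam : ℕ} (hlam : 0 < lam)
    (root : V) {T : Table G η} (hT : ∀ j, lam ≤ T.len j ∧ T.len j ≤ 2 * lam) {ℓ : ℕ}
    {unused : Finset (Short G η)} {s : V} {o : Option V × Finset (Short G η) × List (Round G)}
    (ho : o ∈ (singleRandomWalk hG lam root T ℓ unused s).support) :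
    ∃ d : ℕ, unused.card = o.2.1.card + d ∧ messages o.2.2 = o.2.2.length ∧ lam * d ≤ ℓ ∧
      o.2.2.length ≤ 2 * G.diam * d + (if o.1.isSome then 2 * lam else 0) ∧
      (o.1.isSome → 2 * lam ≤ ℓ → 0 < d) := by
  rw [singleRandomWalk, PMF.mem_support_bind_iff] at ho
  obtain ⟨q, hq, ho⟩ := ho
  obtain ⟨d, t, h1, h2, h3, h4, h5, h6, h7, h8⟩ :=
    of_mem_support_stitch hG hlam root hT ℓ hq (Nat.zero_le _) (by simp)
  simp only [List.nil_append, zero_add] at h1 h2 h5 h8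
  refine ⟨d, ?_⟩
  split_ifs at ho with hb
  · rw [PMF.support_pure, Set.mem_singleton_iff] at ho
    subst ho
    exact ⟨h1, by rw [h2, h4], by omega, by simpa [h2] using h3, by simp⟩
  · rw [Bool.not_eq_true] at hb
    rw [PMF.mem_support_bind_iff] at ho
    obtain ⟨w, hw, ho⟩ := ho
    rw [PMF.support_pure, Set.mem_singleton_iff] at ho
    subst ho
    obtain ⟨hw1, hw2⟩ := of_mem_support_naiveWalk hG _ hw
    have h7 := h7 hb
    refine ⟨h1, ?_, by omega, ?_, fun _ => h8 hb⟩
    · rw [messages_append, h2, h4, hw2, List.length_append, hw1]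
    · simp only [h2, List.length_append, hw1, Option.isSome_some, if_true]
      omega

/-- The cost of `c` completed requests, possibly followed by a failed one, that use `d` short walks.
Each request uses at most `ℓ / lam` short walks, and at least one if it is
completed and `2 * lam ≤ ℓ`; so more requests than there are unused short walks cannot all succeed. -/
theorem of_mem_support_serve (hG : G.Connected) {η : ℝ} {lam : ℕ} [NeZero lam] (root : V)
    {T : Table G η} (hT : ∀ j, lam ≤ T.len j ∧ T.len j ≤ 2 * lam) {ℓ : ℕ}
    (src : List (V × V) → PMF V) (k : ℕ) {pending : Option V} {P P' : Phase G η}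
    (hP : P' ∈ (serve hG lam root T ℓ src k pending P).support) :
    ∃ (d c : ℕ) (t : List (Round G)),
      P.unused.card = P'.unused.card + d ∧ P'.completed = P.completed + c ∧
      P'.rounds = P.rounds ++ t ∧ t.length ≤ 2 * G.diam * d + 2 * lam * c ∧
      messages t = t.length ∧ lam * d ≤ ℓ * (c + 1) ∧ (0 < d → lam ≤ ℓ) ∧
      (2 * lam ≤ ℓ → P.unused.card < k → P'.failed.isSome) := by
  induction k generalizing pending P with
  | zero =>
    rw [serve, PMF.support_pure, Set.mem_singleton_iff] at hP
    subst hP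
    exact ⟨0, 0, [], by simp, by simp, by simp, by simp, rfl, by simp, by simp, by simp⟩
  | succ k ih =>
    simp only [serve, PMF.mem_support_bind_iff] at hP
    obtain ⟨s, -, ⟨o, U, t⟩, ho, hP⟩ := hP
    have hlam : 0 < lam := Nat.pos_of_ne_zero (NeZero.ne lam)
    obtain ⟨d, h1, h2, h3, h4, h5⟩ := of_mem_support_singleRandomWalk hG hlam root hT ho
    have hd : 0 < d → lam ≤ ℓ := fun h => (Nat.le_mul_of_pos_right lam h).trans h3
    cases o with
    | none =>
      simp only [Option.elim_none, PMF.support_pure, Set.mem_singleton_iff] at hP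
      subst hP
      exact ⟨d, 0, t, h1, by simp, rfl, by simpa using h4, h2, by simpa using h3, hd, by simp⟩
    | some v =>
      simp only [Option.elim_some] at hP
      obtain ⟨d', c', t', e1, e2, e3, e4, e5, e6, e7, e8⟩ := ih hP
      simp only [Option.isSome_some, if_true, forall_const] at h1 h2 h4 h5 e1 e2 e3 e8
      refine ⟨d + d', c' + 1, t ++ t', by omega, by omega, ?_, ?_, ?_, ?_, ?_, ?_⟩
      · rw [e3, List.append_assoc]
      · rw [List.length_append]
        linarith
      · rw [messages_append, h2, e5, List.length_append]
      · linarith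
      · intro h
        rcases Nat.eq_zero_or_pos d with h0 | h0
        · exact e7 (by omega)
        · exact hd h0
      · intro hl hk
        have := h5 hl
        exact e8 hl (by omega)

/-! ### The cost per walk in a phase -/

theorem two_mul_edges_mul_log_le_card_short (G : SimpleGraph V) [DecidableRel G.Adj] :
    2 * (G.edgeFinset.card : ℝ) * Real.log (Fintype.card V) ≤ Fintype.card (Short G 1) := by
  rw [Fintype.card_sigma]
  simp only [Fintype.card_fin]
  have h : (2 * G.edgeFinset.card : ℝ) = ∑ v, (G.degree v : ℝ) := by
    exact_mod_cast G.sum_degrees_eq_twice_card_edges.symm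
  rw [h, Finset.sum_mul]
  push_cast
  refine Finset.sum_le_sum fun v _ => ?_
  simpa [numShort] using Nat.le_ceil (1 * (G.degree v : ℝ) * Real.log (Fintype.card V))

theorem half_le_log_card (V : Type*) [Fintype V] [Nontrivial V] :
    1 / 2 ≤ Real.log (Fintype.card V) := by
  have h : (2 : ℝ) ≤ Fintype.card V := by exact_mod_cast Fintype.one_lt_card (α := V)
  have := Real.log_le_log two_pos h
  linarith [Real.log_two_gt_d9]

theorem card_edges_le_card_short (G : SimpleGraph V) [DecidableRel G.Adj] :
    (G.edgeFinset.card : ℝ) ≤ Fintype.card (Short G 1) := by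
  have h1 := two_mul_edges_mul_log_le_card_short G
  have h2 := half_le_log_card V
  have h3 : (0 : ℝ) ≤ G.edgeFinset.card := Nat.cast_nonneg _
  nlinarith

theorem one_le_diam (hG : G.Connected) : 1 ≤ G.diam := by
  obtain ⟨u, v, huv⟩ := exists_pair_ne V
  exact (hG.pos_dist_of_ne huv).trans_le (dist_le_diam hG u v)

theorem card_edges_pos (hG : G.Connected) : 0 < G.edgeFinset.card := by
  obtain ⟨v⟩ := hG.nonempty
  obtain ⟨w, hw⟩ := hG.preconnected.exists_adj_of_nontrivial v
  exact Finset.card_pos.2 ⟨s(v, w), by simpa using hw⟩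

/-- The cost of routing `d` short walks, where `K` stands for the number of walks and `x` for the
power of `log n` by which `lam` may fall short of `√(ℓ * D)`. -/
theorem routing_cost_le {c₁ ℓ D lam K d x : ℝ} (hc₁ : 0 < c₁) (hℓ : 0 ≤ ℓ) (hD : 0 ≤ D)
    (hlam : 0 < lam) (hK : 0 ≤ K) (hx : 0 < x) (hd : lam * d ≤ 2 * ℓ * K)
    (h : c₁ * √(ℓ * D) / x ≤ lam) :
    2 * D * d ≤ K * (4 / c₁ * x * √(ℓ * D)) := by
  have hs : √(ℓ * D) * √(ℓ * D) = ℓ * D := Real.mul_self_sqrt (by positivity)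
  set s := √(ℓ * D)
  have hs0 : 0 ≤ s := Real.sqrt_nonneg _
  have h1 : c₁ * s ≤ lam * x := (div_le_iff₀ hx).1 h
  have h2 : s ≤ lam * x / c₁ := by
    rw [le_div_iff₀ hc₁]
    linarith
  refine le_of_mul_le_mul_left ?_ hlam
  calc lam * (2 * D * d) = 2 * D * (lam * d) := by ring
    _ ≤ 2 * D * (2 * ℓ * K) := by gcongr
    _ = 4 * K * s * s := by rw [mul_assoc _ s s, hs]; ring
    _ ≤ 4 * K * s * (lam * x / c₁) := by gcongr
    _ = lam * (K * (4 / c₁ * x * s)) := by ring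

/-- The average number of rounds when `d` of `N` short walks are used for `K` walks. Here `L` stands
for `log n` and `m` for the number of edges. The summands of `R` stand for the set-up of the tree,
pre-processing, routing and the naive walks. Since `K ≥ lam * d / (2 * ℓ)` and `N ≥ 2 * m * L`, the
cost `4 * lam * B` of pre-processing contributes `O(ℓ / (κ * m))` per walk, with `κ = d / N`. -/
theorem rounds_per_walk_le {c₁ c₂ ℓ D lam K d N m L B R : ℝ} {a b : ℕ} (hc₁ : 0 < c₁)
    (hc₂ : 0 < c₂) (hℓ : 0 ≤ ℓ) (hD : 1 ≤ D) (hlam : 0 < lam) (hK : 1 ≤ K) (hdpos : 0 < d)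
    (hm : 0 < m) (hL : 1 ≤ L) (hN : 2 * m * L ≤ N) (hB : B ≤ 14 * L)
    (hd : lam * d ≤ 2 * ℓ * K) (h₁ : c₁ * √(ℓ * D) / L ^ a ≤ lam)
    (h₂ : lam ≤ c₂ * √(ℓ * D) * L ^ b)
    (hR : R ≤ 3 * (D + 1) + 4 * lam * B + 2 * D * d + 2 * lam * K) :
    R / K ≤ (100 + 4 / c₁ + 2 * c₂ + 4 / c₁ ^ 2) * L ^ (a + b) *
      (ℓ / (d / N * m) + √(ℓ * D) + D) := by
  have hL0 : 0 < L := by linarith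
  have hN0 : 0 < N := lt_of_lt_of_le (by positivity) hN
  have e1 : 2 * D * d ≤ K * (4 / c₁ * L ^ a * √(ℓ * D)) :=
    routing_cost_le hc₁ hℓ (by linarith) hlam (by linarith) (by positivity) hd h₁
  have e2 : 4 * lam * B ≤ K * (56 * (ℓ / (d / N * m))) := by
    have : lam * L ≤ K * (ℓ / (d / N * m)) := by
      rw [div_mul_eq_mul_div, div_div_eq_mul_div, ← mul_div_assoc, le_div_iff₀ (by positivity)]
      calc lam * L * (d * m) = (lam * d) * (m * L) := by ring
        _ ≤ (2 * ℓ * K) * (m * L) := by gcongr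
        _ = K * (ℓ * (2 * m * L)) := by ring
        _ ≤ K * (ℓ * N) := by gcongr
    nlinarith
  have ha : L ^ a ≤ L ^ (a + b) := pow_le_pow_right₀ hL (Nat.le_add_right _ _)
  have hb : L ^ b ≤ L ^ (a + b) := pow_le_pow_right₀ hL (Nat.le_add_left _ _)
  have hab : 1 ≤ L ^ (a + b) := one_le_pow₀ hL
  have hq : 0 ≤ ℓ / (d / N * m) := by positivity
  set q := ℓ / (d / N * m)
  set s := √(ℓ * D)
  have hs : 0 ≤ s := Real.sqrt_nonneg _
  set X := L ^ (a + b)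
  have i1 : 4 / c₁ * L ^ a * s ≤ 4 / c₁ * X * s := by gcongr
  have i2 : 2 * lam ≤ 2 * c₂ * X * s :=
    calc 2 * lam ≤ 2 * (c₂ * s * L ^ b) := by gcongr
      _ ≤ 2 * (c₂ * s * X) := by gcongr
      _ = 2 * c₂ * X * s := by ring
  have hK0 : 0 < K := by linarith
  rw [div_le_iff₀ hK0]
  have i3 : R ≤ K * (6 * D + 56 * q + 4 / c₁ * X * s + 2 * c₂ * X * s) := by
    have j1 : 3 * (D + 1) ≤ K * (6 * D) := by nlinarith
    have j2 := mul_le_mul_of_nonneg_left i1 hK0.le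
    have j3 := mul_le_mul_of_nonneg_left i2 hK0.le
    linarith
  refine i3.trans ?_
  rw [mul_comm _ K]
  refine mul_le_mul_of_nonneg_left ?_ hK0.le
  have k1 : 6 * D ≤ 100 * X * D := by nlinarith
  have k2 : 56 * q ≤ 100 * X * q := by nlinarith
  have k3 : 0 ≤ 100 * X * s := by positivity
  have k4 : 0 ≤ (4 / c₁ + 2 * c₂ + 4 / c₁ ^ 2) * X * (q + D) := by positivity
  have k5 : 0 ≤ 4 / c₁ ^ 2 * X * s := by positivity
  linarith

/-- The counterpart of `rounds_per_walk_le` for messages. Here `lam ≤ ℓ`, so that the terms `lam` and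
`√(ℓ * D) ≤ lam / c₁` are absorbed in `ℓ / κ`. -/
theorem messages_per_walk_le {c₁ c₂ ℓ D lam K d N m M : ℝ} (hc₁ : 0 < c₁)
    (hc₂ : 0 < c₂) (hD : 1 ≤ D) (hlam : 1 ≤ lam) (hK : 1 ≤ K) (hdpos : 0 < d)
    (hm : 0 < m) (hN : m ≤ N) (hdN : d ≤ N) (hlℓ : lam ≤ ℓ)
    (hd : lam * d ≤ 2 * ℓ * K) (h₁ : c₁ * √(ℓ * D) ≤ lam)
    (hM : M ≤ 6 * m + 4 * lam * N + 2 * D * d + 2 * lam * K) :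
    M / K ≤ (100 + 4 / c₁ + 2 * c₂ + 4 / c₁ ^ 2) * (ℓ / (d / N) + D) := by
  have hN0 : 0 < N := by linarith
  have hℓ : 0 < ℓ := by linarith
  have hK0 : 0 < K := by linarith
  have e1 : 2 * D * d ≤ K * (4 / c₁ * 1 * √(ℓ * D)) :=
    routing_cost_le hc₁ hℓ.le (by linarith) (by linarith) (by linarith) one_pos hd
      (by rwa [div_one])
  have hq : ℓ ≤ ℓ / (d / N) := by
    rw [div_div_eq_mul_div, le_div_iff₀ hdpos]
    gcongr
  have e2 : lam * N ≤ 2 * K * (ℓ / (d / N)) := by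
    rw [div_div_eq_mul_div, ← mul_div_assoc, le_div_iff₀ hdpos]
    nlinarith
  set q := ℓ / (d / N)
  have e3 : 4 / c₁ * 1 * √(ℓ * D) ≤ 4 / c₁ ^ 2 * q := by
    have : √(ℓ * D) ≤ q / c₁ := by
      rw [le_div_iff₀ hc₁]
      linarith
    calc 4 / c₁ * 1 * √(ℓ * D) ≤ 4 / c₁ * 1 * (q / c₁) := by gcongr
      _ = 4 / c₁ ^ 2 * q := by ring
  rw [div_le_iff₀ hK0]
  have i1 : M ≤ K * (22 * q + 4 / c₁ ^ 2 * q) := by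
    have j1 : m ≤ lam * N := by nlinarith
    have j2 := mul_le_mul_of_nonneg_left e3 hK0.le
    have j3 : lam * K ≤ K * q := by nlinarith
    linarith
  refine i1.trans ?_
  rw [mul_comm _ K]
  refine mul_le_mul_of_nonneg_left ?_ hK0.le
  have k1 : 0 ≤ q := by linarith
  have k2 : 0 ≤ (100 + 4 / c₁ + 2 * c₂ + 4 / c₁ ^ 2) * D := by positivity
  have k3 : 0 ≤ (4 / c₁ + 2 * c₂) * q := by positivity
  linarith

/-- A threshold `A` for the congestion that is logarithmic in the number of nodes. -/
theorem exists_two_pow_ge {n : ℕ} (hn : 3 ≤ n) :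
    ∃ A : ℕ, 2 * n ^ 4 ≤ 2 ^ A ∧ (A + 1 : ℝ) ≤ 14 * Real.log n ∧ 1 ≤ Real.log n := by
  have hn3 : (3 : ℝ) ≤ n := by exact_mod_cast hn
  have hL : 1 ≤ Real.log n := by
    rw [Real.le_log_iff_exp_le (by linarith)]
    linarith [Real.exp_one_lt_d9]
  refine ⟨4 * (Nat.log 2 n + 1) + 1, ?_, ?_, hL⟩
  · have h := (Nat.lt_pow_succ_log_self one_lt_two n).le
    calc 2 * n ^ 4 ≤ 2 * (2 ^ (Nat.log 2 n + 1)) ^ 4 := by gcongr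
      _ = 2 ^ (4 * (Nat.log 2 n + 1) + 1) := by rw [pow_succ 2 (4 * _), ← pow_mul]; ring
  · have h : ((2 ^ Nat.log 2 n : ℕ) : ℝ) ≤ n := by
      exact_mod_cast Nat.pow_log_le_self 2 (by omega)
    have h2 := Real.log_le_log (by positivity) h
    push_cast at h2 ⊢
    rw [Real.log_pow] at h2
    have h3 : (0 : ℝ) ≤ Nat.log 2 n := Nat.cast_nonneg _
    nlinarith [Real.log_two_gt_d9]

theorem kappa_eq {P : Phase G 1} {d : ℕ}
    (h : (univ : Finset (Short G 1)).card = P.unused.card + d) :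
    P.kappa = d / (Fintype.card (Short G 1) : ℝ) := by
  have h' : (Fintype.card (Short G 1) : ℝ) = P.unused.card + d := by
    rw [← Finset.card_univ]
    exact_mod_cast h
  rw [Phase.kappa]
  congr 1
  linarith

theorem pos_of_kappa_pos {P : Phase G 1} {d : ℕ}
    (h : (univ : Finset (Short G 1)).card = P.unused.card + d) (hP : 0 < P.kappa) : 0 < d := by
  rw [kappa_eq h] at hP
  rcases Nat.eq_zero_or_pos d with rfl | hd
  · simp at hP
  · exact hd

theorem lam_mul_used_le {lam d ℓ c : ℕ} (h : lam * d ≤ ℓ * (c + 1)) :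
    (lam : ℝ) * d ≤ 2 * ℓ * max (c : ℝ) 1 := by
  have h' : (lam : ℝ) * d ≤ ℓ * (c + 1) := by exact_mod_cast h
  have h0 : (0 : ℝ) ≤ ℓ := Nat.cast_nonneg _
  have h1 : (c : ℝ) ≤ max (c : ℝ) 1 := le_max_left _ _
  have h2 : (1 : ℝ) ≤ max (c : ℝ) 1 := le_max_right _ _
  nlinarith

variable (hG : G.Connected) {lam : ℕ} [NeZero lam] (root : V) {ℓ : ℕ}
  (src : List (V × V) → PMF V) {k : ℕ} {setup : List (Round G)} (history : List (V × V))
  (pending : Option V)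

include hG

theorem failed_of_mem_support_phase {P : Phase G 1}
    (hP : P ∈ (phase hG 1 lam root ℓ src k setup history pending).support) (hℓ : 2 * lam ≤ ℓ)
    (hk : Fintype.card (Short G 1) < k) : P.failed.isSome := by
  rw [phase, PMF.mem_support_bind_iff] at hP
  obtain ⟨p, hp, hP⟩ := hP
  obtain ⟨d, c, t, -, -, -, -, -, -, -, h⟩ :=
    of_mem_support_serve hG root (of_mem_support_preProcessing hG lam hp).1 src k hP
  exact h hℓ (by simpa using hk)

theorem messages_per_walk_of_mem_support_phase {c₁ c₂ : ℝ} (hc₁ : 0 < c₁) (hc₂ : 0 < c₂)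
    (hsetup : messages setup ≤ 3 * Fintype.card G.Dart)
    (h₁ : c₁ * √((ℓ : ℝ) * G.diam) ≤ lam) {P : Phase G 1}
    (hP : P ∈ (phase hG 1 lam root ℓ src k setup history pending).support) (hκ : 0 < P.kappa) :
    (messages P.rounds : ℝ) / max (P.completed : ℝ) 1 ≤
      (100 + 4 / c₁ + 2 * c₂ + 4 / c₁ ^ 2) * (ℓ / P.kappa + G.diam) := by
  rw [phase, PMF.mem_support_bind_iff] at hP
  obtain ⟨p, hp, hP⟩ := hP
  obtain ⟨hT, hpm⟩ := of_mem_support_preProcessing hG lam hp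
  obtain ⟨d, c, t, h1, h2, h3, h4, h5, h6, h7, -⟩ := of_mem_support_serve hG root hT src k hP
  simp only [zero_add] at h1 h2 h3
  have hd := pos_of_kappa_pos h1 hκ
  rw [kappa_eq h1, h2]
  rw [SimpleGraph.dart_card_eq_twice_card_edges] at hsetup
  have hM : messages P.rounds ≤ 6 * G.edgeFinset.card + 4 * lam * Fintype.card (Short G 1) +
      2 * G.diam * d + 2 * lam * c := by
    rw [h3, messages_append, messages_append, h5]
    omega
  have hM' : (messages P.rounds : ℝ) ≤ 6 * G.edgeFinset.card +
      4 * lam * Fintype.card (Short G 1) + 2 * G.diam * d + 2 * lam * c := by exact_mod_cast hM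
  refine messages_per_walk_le (lam := lam) hc₁ hc₂ (by exact_mod_cast one_le_diam hG)
    (by exact_mod_cast Nat.pos_of_ne_zero (NeZero.ne lam)) (le_max_right _ _)
    (by exact_mod_cast hd) (by exact_mod_cast card_edges_pos hG) (card_edges_le_card_short G)
    (by rw [← Finset.card_univ]; exact_mod_cast (by omega))
    (by exact_mod_cast h7 hd) (lam_mul_used_le h6) h₁ (hM'.trans ?_)
  gcongr
  exact le_max_left _ _

theorem rounds_per_walk_tail_phase {c₁ c₂ : ℝ} (hc₁ : 0 < c₁) (hc₂ : 0 < c₂) {a b : ℕ}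
    (hsetup : setup.length ≤ 3 * (G.diam + 1))
    (h₁ : c₁ * √((ℓ : ℝ) * G.diam) / Real.log (Fintype.card V) ^ a ≤ lam)
    (h₂ : (lam : ℝ) ≤ c₂ * √((ℓ : ℝ) * G.diam) * Real.log (Fintype.card V) ^ b) :
    ENNReal.ofReal (1 - 2 / (Fintype.card V : ℝ)) ≤
      (phase hG 1 lam root ℓ src k setup history pending).toOuterMeasure
        {P | 0 < P.kappa → (P.rounds.length : ℝ) / max (P.completed : ℝ) 1 ≤
          (100 + 4 / c₁ + 2 * c₂ + 4 / c₁ ^ 2) * Real.log (Fintype.card V) ^ (a + b) *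
            (ℓ / (P.kappa * G.edgeFinset.card) + √((ℓ : ℝ) * G.diam) + G.diam)} := by
  have hn2 : 2 ≤ Fintype.card V := Fintype.one_lt_card
  -- for two nodes the probability on the left is zero
  rcases hn2.eq_or_lt with hn | hn
  · simp [← hn]
  obtain ⟨A, hA, hB, hL⟩ := exists_two_pow_ge hn
  refine (preProcessing_length_tail hG lam A hA).trans
    (toOuterMeasure_le_toOuterMeasure_bind _ _ _ _ fun p hp hpA P hP hκ => ?_)
  obtain ⟨hT, -⟩ := of_mem_support_preProcessing hG lam hp
  obtain ⟨d, c, t, h1, h2, h3, h4, h5, h6, h7, -⟩ := of_mem_support_serve hG root hT src k hP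
  simp only [zero_add, Set.mem_ofPred_eq] at h1 h2 h3 hpA
  have hd := pos_of_kappa_pos h1 hκ
  rw [kappa_eq h1, h2]
  have hR : P.rounds.length ≤ 3 * (G.diam + 1) + 4 * lam * (A + 1) + 2 * G.diam * d +
      2 * lam * c := by
    rw [h3, List.length_append, List.length_append]
    omega
  have hR' : (P.rounds.length : ℝ) ≤ 3 * (G.diam + 1) + 4 * lam * (A + 1) + 2 * G.diam * d +
      2 * lam * c := by exact_mod_cast hR
  refine rounds_per_walk_le (lam := lam) (B := A + 1) hc₁ hc₂ (Nat.cast_nonneg _)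
    (by exact_mod_cast one_le_diam hG)
    (by exact_mod_cast Nat.pos_of_ne_zero (NeZero.ne lam)) (le_max_right _ _)
    (by exact_mod_cast hd) (by exact_mod_cast card_edges_pos hG) hL
    (two_mul_edges_mul_log_le_card_short G) hB (lam_mul_used_le h6) h₁ h₂ (hR'.trans ?_)
  gcongr
  exact le_max_left _ _

/-! ### The sequence of phases -/

theorem failed_of_mem_support_continuousRandomWalk (hℓ : 2 * lam ≤ ℓ)
    (hk : Fintype.card (Short G 1) < k) (i : ℕ) {o : Option (Phase G 1)}
    (ho : o ∈ (continuousRandomWalk hG lam root ℓ src k i).support) :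
    ∃ P, o = some P ∧ P.failed.isSome := by
  induction i generalizing o with
  | zero =>
    rw [continuousRandomWalk, PMF.mem_support_map_iff] at ho
    obtain ⟨P, hP, rfl⟩ := ho
    exact ⟨P, rfl, failed_of_mem_support_phase hG root src _ _ hP hℓ hk⟩
  | succ i ih =>
    rw [continuousRandomWalk, PMF.mem_support_bind_iff] at ho
    obtain ⟨o', ho', ho⟩ := ho
    obtain ⟨P', rfl, hP'⟩ := ih ho'
    obtain ⟨s, hs⟩ := Option.isSome_iff_exists.1 hP'
    simp only [Option.bind_some, hs, Option.map_some, Option.elim_some,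
      PMF.mem_support_map_iff] at ho
    obtain ⟨P, hP, rfl⟩ := ho
    exact ⟨P, rfl, failed_of_mem_support_phase hG root src _ _ hP hℓ hk⟩

theorem exists_phase_of_mem_support_continuousRandomWalk (i : ℕ) {P : Phase G 1}
    (hP : some P ∈ (continuousRandomWalk hG lam root ℓ src k i).support) :
    ∃ (setup : List (Round G)) (history : List (V × V)) (pending : Option V),
      messages setup ≤ 3 * Fintype.card G.Dart ∧
      P ∈ (phase hG 1 lam root ℓ src k setup history pending).support := by
  cases i with
  | zero =>
    rw [continuousRandomWalk, PMF.mem_support_map_iff] at hP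
    obtain ⟨P', hP', h⟩ := hP
    cases h
    exact ⟨_, _, _, messages_treeSetup_le root, hP'⟩
  | succ i =>
    rw [continuousRandomWalk, PMF.mem_support_bind_iff] at hP
    obtain ⟨o, -, hP⟩ := hP
    rcases ho : o.bind fun P => P.failed.map fun s => (P.history, s) with _ | q
    · simp [ho] at hP
    · simp only [ho, Option.elim_some, PMF.mem_support_map_iff] at hP
      obtain ⟨P', hP', h⟩ := hP
      cases h
      exact ⟨_, _, _, by simp [messages_nil], hP'⟩

/-- What is likely in every phase, whatever happened before, is likely in the `i`-th phase. -/
theorem le_toOuterMeasure_continuousRandomWalk (i : ℕ) (S : Set (Phase G 1)) {c : ℝ≥0∞}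
    (hc : c ≤ 1)
    (h : ∀ (setup : List (Round G)) (history : List (V × V)) (pending : Option V),
      setup.length ≤ 3 * (G.diam + 1) →
        c ≤ (phase hG 1 lam root ℓ src k setup history pending).toOuterMeasure S) :
    c ≤ (continuousRandomWalk hG lam root ℓ src k i).toOuterMeasure
      {o | ∀ P, o = some P → P ∈ S} := by
  have hS : (some : Phase G 1 → _) ⁻¹' {o | ∀ P, o = some P → P ∈ S} = S := by
    ext P
    simp
  cases i with
  | zero =>
    rw [continuousRandomWalk, PMF.toOuterMeasure_map_apply, hS]
    exact h _ _ _ (length_treeSetup root).le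
  | succ i =>
    rw [continuousRandomWalk]
    refine le_toOuterMeasure_bind _ _ _ _ fun o _ => ?_
    rcases o.bind fun P => P.failed.map fun s => (P.history, s) with _ | q
    · rw [Option.elim_none, toOuterMeasure_eq_one_of_support_subset]
      · exact hc
      · simp
    · rw [Option.elim_some, PMF.toOuterMeasure_map_apply, hS]
      exact h _ _ _ (by simp)

end

end RWNet

theorem mainTheorem3 (c₁ c₂ : ℝ) (hc₁ : 0 < c₁) (hc₂ : 0 < c₂) (a b : ℕ) :
    ∃ C : ℝ, 0 < C ∧ ∃ p : ℕ,
      ∀ (V : Type*) [Fintype V] [DecidableEq V] [Nontrivial V]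
        (G : SimpleGraph V) [DecidableRel G.Adj] (hG : G.Connected)
        (root : V) (src : List (V × V) → PMF V)
        (ℓ lam : ℕ) [NeZero lam],
        1 ≤ ℓ →
        c₁ * √((ℓ : ℝ) * G.diam) / Real.log (Fintype.card V) ^ a ≤ lam →
        (lam : ℝ) ≤ c₂ * √((ℓ : ℝ) * G.diam) * Real.log (Fintype.card V) ^ b →
        ∀ i k : ℕ,
          -- every phase ends by the failure of a request once short walks are used at all
          (2 * lam ≤ ℓ → Fintype.card (RWNet.Short G 1) < k →
            ∀ o ∈ (RWNet.continuousRandomWalk hG lam root ℓ src k i).support,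
              ∃ P, o = some P ∧ P.failed.isSome) ∧
          -- rounds per walk, with high probability
          ENNReal.ofReal (1 - 2 / (Fintype.card V : ℝ)) ≤
            (RWNet.continuousRandomWalk hG lam root ℓ src k i).toOuterMeasure
              {o | ∀ P, o = some P → 0 < P.kappa →
                (P.rounds.length : ℝ) / max (P.completed : ℝ) 1 ≤
                  C * Real.log (Fintype.card V) ^ p *
                    (ℓ / (P.kappa * G.edgeFinset.card) + √((ℓ : ℝ) * G.diam) + G.diam)} ∧
          -- messages per walk
          (c₁ * √((ℓ : ℝ) * G.diam) ≤ lam →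
            ∀ P, some P ∈ (RWNet.continuousRandomWalk hG lam root ℓ src k i).support →
              0 < P.kappa →
              (RWNet.messages P.rounds : ℝ) / max (P.completed : ℝ) 1 ≤
                C * (ℓ / P.kappa + G.diam)) := by
  refine ⟨100 + 4 / c₁ + 2 * c₂ + 4 / c₁ ^ 2, by positivity, a + b, ?_⟩
  intro V _ _ _ G _ hG root src ℓ lam _ _ h₁ h₂ i k
  refine ⟨fun hℓ hk o ho =>
    RWNet.failed_of_mem_support_continuousRandomWalk hG root src hℓ hk i ho, ?_, ?_⟩
  · refine RWNet.le_toOuterMeasure_continuousRandomWalk hG root src i {P | _} ?_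
      fun setup history pending hs =>
        RWNet.rounds_per_walk_tail_phase hG root src history pending hc₁ hc₂ hs h₁ h₂
    rw [ENNReal.ofReal_le_one, sub_le_self_iff]
    positivity
  · intro h₃ P hP hκ
    obtain ⟨setup, history, pending, hs, hP⟩ :=
      RWNet.exists_phase_of_mem_support_continuousRandomWalk hG root src i hP
    exact RWNet.messages_per_walk_of_mem_support_phase hG root src history pending hc₁ hc₂ hs h₃
      hP hκ
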